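/- Let $\rho>0$, let $M=\mathbb S^1\times[-\rho,\rho]$, and let $g_0$ be a smooth Riemannian metric on $M$. For a metric $g$ let $R_g$ be its scalar curvature and $k_g$ the geodesic curvature of $\partial M$ (with respect to the inward unit normal, so that round discs have $k>0$). Let $\tilde g(\tilde t)$, $0\le \tilde t<\tilde T\le\infty$, be a solution of the unnormalised Ricci flow $$\frac{\partial\tilde g}{\partial\tilde t}=-\tilde R\,\tilde g\ \text{ in } M\times(0,\tilde T),\qquad k_{\tilde g}=k_{g_0}\ \text{ on }\partial M\times(0,\tilde T),\qquad \tilde g(0)=g_0,$$ smooth up to $\partial M$ for $\tilde t>0$ and continuous on $M\times[0,\tilde T)$. Put $\phi(\tilde t)=1/A_{\tilde g(\tilde t)}(M)$ and $t(\tilde t)=\int_0^{\tilde t}\phi(\tau)\,d\tau$. The normalised flow is $g(t(\tilde t))=\phi(\tilde t)\,\tilde g(\tilde t)$, which has area $1$ and is defined for $0\le t<T$, where $T=\lim_{\tilde t\to\tilde T}t(\tilde t)\le\infty$. Suppose that $k_{g_0}<0$ on $\partial M$, that $k_{g_0}$ is constant on each component of $\partial M$, and that there is $C>0$ such that the length of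 the boundary satisfies $l_{g(t)}(\partial M)\ge C$ for all $t\in[0,T)$. Then: 1. there is a constant $c_1>0$ such that $\int_M\tilde R^2\,dA_{\tilde g}\ge c_1$ for all $\tilde t\in[0,\tilde T)$; 2. there is a constant $c_2>0$ such that $\tilde R_{\max}(\tilde t):=\max_M\tilde R(\cdot,\tilde t)\ge c_2\,\tilde t$ for all $\tilde t\in[0,\tilde T)$; 3. if the normalised flow exists for all time, that is $T=\infty$ (in particular if $\tilde T=\infty$), then $\tilde R_{\max}(\tilde t)\to\infty$ as $\tilde t\to\tilde T$. -/

import Mathlib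

open scoped ContDiff

noncomputable section

namespace CylinderFlow

/-! The cylinder `M = S¹ × [-ρ, ρ]` is described by its universal cover, the strip
`ℝ × [-ρ, ρ]` with coordinates `(θ, s)`: index `0` is `θ`, index `1` is `s`, and everything that
lives on `M` is `2π`-periodic in `θ`. -/

/-- The strip `ℝ × [-ρ, ρ]`, the universal cover of the cylinder. -/
def strip (ρ : ℝ) : Set (ℝ × ℝ) := {p | p.2 ∈ Set.Icc (-ρ) ρ}

/-- The two boundary lines of the strip; they cover the two boundary circles of the cylinder. -/
def bdry (ρ : ℝ) : Set (ℝ × ℝ) := {p | p.2 = ρ ∨ p.2 = -ρ}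

/-- A fundamental domain of the cylinder. -/
def cell (ρ : ℝ) : Set (ℝ × ℝ) := Set.Icc 0 (2 * Real.pi) ×ˢ Set.Icc (-ρ) ρ

/-- A field of `2 × 2` matrices `g p i j`: the components of a metric in the coordinates. -/
abbrev MetricField := ℝ × ℝ → Matrix (Fin 2) (Fin 2) ℝ

/-- `g` is (the lift of) a Riemannian metric on the cylinder, smooth up to the boundary. -/
structure IsMetric (ρ : ℝ) (g : MetricField) : Prop where
  smooth : ∀ i j, ContDiffOn ℝ ∞ (fun p => g p i j) (strip ρ)
  periodic : ∀ p ∈ strip ρ, g (p.1 + 2 * Real.pi, p.2) = g p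
  posDef : ∀ p ∈ strip ρ, (g p).PosDef

/-- Coordinate vectors. -/
def basisVec (i : Fin 2) : ℝ × ℝ := if i = 0 then (1, 0) else (0, 1)

/-- Partial derivative in the `i`-th coordinate (one-sided in `s` at the boundary). -/
def pd (ρ : ℝ) (i : Fin 2) (f : ℝ × ℝ → ℝ) (p : ℝ × ℝ) : ℝ :=
  fderivWithin ℝ f (strip ρ) p (basisVec i)

/-- Christoffel symbol `Γ^k_{ij}` of the Levi-Civita connection. -/
def christoffel (ρ : ℝ) (g : MetricField) (k i j : Fin 2) (p : ℝ × ℝ) : ℝ :=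
  (1 / 2) * ∑ l, (g p)⁻¹ k l *
    (pd ρ i (fun q => g q j l) p + pd ρ j (fun q => g q i l) p - pd ρ l (fun q => g q i j) p)

/-- Ricci curvature
`Ric_{ij} = ∂_k Γ^k_{ij} - ∂_j Γ^k_{ik} + Γ^k_{kl} Γ^l_{ij} - Γ^k_{jl} Γ^l_{ik}`. -/
def ricci (ρ : ℝ) (g : MetricField) (i j : Fin 2) (p : ℝ × ℝ) : ℝ :=
  ∑ k, (pd ρ k (christoffel ρ g k i j) p - pd ρ j (christoffel ρ g k i k) p
    + ∑ l, (christoffel ρ g k k l p * christoffel ρ g l i j p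
      - christoffel ρ g k j l p * christoffel ρ g l i k p))

/-- Scalar curvature `R = g^{ij} Ric_{ij}` (twice the Gauss curvature). -/
def scalarCurvature (ρ : ℝ) (g : MetricField) (p : ℝ × ℝ) : ℝ :=
  ∑ i, ∑ j, (g p)⁻¹ i j * ricci ρ g i j p

/-- The inward unit normal at a boundary point: `-sign(s) ∇s / |∇s|`, where
`(∇s)^i = g^{i1}` and `|∇s|² = g^{11}`. -/
def inwardNormal (g : MetricField) (p : ℝ × ℝ) (i : Fin 2) : ℝ :=
  -Real.sign p.2 * (g p)⁻¹ i 1 / √((g p)⁻¹ 1 1)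

/-- Geodesic curvature `g(∇_τ τ, ν)` of the boundary, where `τ = ∂_θ / |∂_θ|` is the unit tangent
and `ν` the inward unit normal (positive for round discs). Since `ν ⟂ ∂_θ`, it equals
`g(∇_{∂_θ} ∂_θ, ν) / g(∂_θ, ∂_θ)`, with `∇_{∂_θ} ∂_θ = Γ^k_{00} ∂_k`. -/
def geodesicCurvature (ρ : ℝ) (g : MetricField) (p : ℝ × ℝ) : ℝ :=
  (∑ k, ∑ l, g p k l * christoffel ρ g k 0 0 p * inwardNormal g p l) / g p 0 0

/-- The integral `∫_M f dA_g`. -/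
def integralM (ρ : ℝ) (g : MetricField) (f : ℝ × ℝ → ℝ) : ℝ :=
  ∫ p in cell ρ, f p * √((g p).det)

/-- The area `A_g(M)`. -/
def area (ρ : ℝ) (g : MetricField) : ℝ := integralM ρ g (fun _ => 1)

/-- The total length `l_g(∂M)` of the boundary. -/
def boundaryLength (ρ : ℝ) (g : MetricField) : ℝ :=
  (∫ θ in (0 : ℝ)..(2 * Real.pi), √(g (θ, ρ) 0 0)) +
    ∫ θ in (0 : ℝ)..(2 * Real.pi), √(g (θ, -ρ) 0 0)

/-- The maximum of the scalar curvature over `M`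
(for a metric the supremum is attained, by compactness of `M`). -/
def scalarMax (ρ : ℝ) (g : MetricField) : ℝ := sSup (scalarCurvature ρ g '' strip ρ)

/-- `gt` is a solution on `[0, T)`, `T ≤ ∞`, of the unnormalised Ricci flow
`∂g/∂t = -R g` in `M × (0, T)`, `k_g = k_{g₀}` on `∂M × (0, T)`, `g = g₀` at `t = 0`:
smooth for positive times up to the boundary of `M`, and continuous up to time `0`. -/
structure IsRicciFlow (ρ : ℝ) (T : EReal) (g₀ : MetricField) (gt : ℝ → MetricField) : Prop where
  metric : ∀ t : ℝ, 0 ≤ t → (t : EReal) < T → IsMetric ρ (gt t)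
  smooth : ∀ i j, ContDiffOn ℝ ∞ (fun q : ℝ × (ℝ × ℝ) => gt q.1 q.2 i j)
    {q | 0 < q.1 ∧ (q.1 : EReal) < T ∧ q.2 ∈ strip ρ}
  continuous : ∀ i j, ContinuousOn (fun q : ℝ × (ℝ × ℝ) => gt q.1 q.2 i j)
    {q | 0 ≤ q.1 ∧ (q.1 : EReal) < T ∧ q.2 ∈ strip ρ}
  evolution : ∀ t : ℝ, 0 < t → (t : EReal) < T → ∀ p ∈ strip ρ, ∀ i j,
    HasDerivAt (fun τ => gt τ p i j) (-scalarCurvature ρ (gt t) p * gt t p i j) t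
  boundary : ∀ t : ℝ, 0 < t → (t : EReal) < T → ∀ p ∈ bdry ρ,
    geodesicCurvature ρ (gt t) p = geodesicCurvature ρ g₀ p
  initial : ∀ p ∈ strip ρ, gt 0 p = g₀ p

/-- The scaling factor `φ` for which `φ g` has area `1`. -/
def scaling (ρ : ℝ) (gt : ℝ → MetricField) (τ : ℝ) : ℝ := 1 / area ρ (gt τ)

/-- The rescaled time `t(τ) = ∫₀^τ φ`. -/
def rescaledTime (ρ : ℝ) (gt : ℝ → MetricField) (τ : ℝ) : ℝ :=
  ∫ σ in (0 : ℝ)..τ, scaling ρ gt σ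

/-- `g`, on the time interval `[0, S)`, is the normalised flow obtained from the unnormalised flow
`gt` on `[0, T)`: rescaled time maps `[0, T)` onto `[0, S)`, and `g(t(τ)) = φ(τ) gt(τ)`. -/
structure IsNormalisation (ρ : ℝ) (T : EReal) (gt : ℝ → MetricField)
    (S : EReal) (g : ℝ → MetricField) : Prop where
  time_lt : ∀ τ : ℝ, 0 ≤ τ → (τ : EReal) < T → (rescaledTime ρ gt τ : EReal) < S
  time_surj : ∀ t : ℝ, 0 ≤ t → (t : EReal) < S →
    ∃ τ : ℝ, 0 ≤ τ ∧ (τ : EReal) < T ∧ rescaledTime ρ gt τ = t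
  metric_eq : ∀ τ : ℝ, 0 ≤ τ → (τ : EReal) < T → ∀ p ∈ strip ρ,
    g (rescaledTime ρ gt τ) p = scaling ρ gt τ • gt τ p

end CylinderFlow

end

noncomputable section

namespace CylinderFlow

open MeasureTheory

variable {ρ t : ℝ} {T : EReal} {f h : ℝ × ℝ → ℝ} {g g₀ : MetricField} {gt : ℝ → MetricField}
  {p : ℝ × ℝ}

/-! The cylinder has Euler characteristic zero, so Gauss–Bonnet gives `∫ R dA = -2 ∫ k dl ≥ 2κ
l(∂M)`, where `-κ < 0` is the larger of the two boundary curvatures. Normalising to area one divides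
lengths by `√A`, so the hypothesis reads `l(∂M) ≥ C √A` for the unnormalised metric, and hence `∫ R
dA ≥ a √A` with `a = 2κC`. Everything follows from this inequality.

Cauchy–Schwarz turns it into `∫ R² dA ≥ a²`, and `∫ R dA ≤ R_max A` turns it into `R_max ≥ a / √A`.
Since `A' = -∫ R dA`, also `(√A)' ≤ -a/2` (`IsRicciFlow.sqrt_area_add_le`): the area decreases and
the lifetime is at most `2 √A(0) / a`. Thus `R_max` is bounded below by a positive constant on a
bounded time interval, which gives the linear bound. If the area stayed away from zero, the rescaled
time would be bounded; so `S = ⊤` forces `A → 0` and `R_max → ∞`.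

Gauss–Bonnet is proved in coordinates: `R dA` is twice the exterior derivative of a connection form
(Liouville), whose boundary values are `∓ k dl`, and the divergence theorem applies on a fundamental
cell. -/

/-- Smoothness up to the boundary of the strip. -/
def SmoothOn (ρ : ℝ) (f : ℝ × ℝ → ℝ) : Prop := ContDiffOn ℝ ∞ f (strip ρ)

/-! ### Calculus on the strip, with one-sided derivatives at the boundary. -/

theorem strip_eq_prod : strip ρ = Set.univ ×ˢ Set.Icc (-ρ) ρ := by ext; simp [strip]

theorem uniqueDiffOn_strip (hρ : 0 < ρ) : UniqueDiffOn ℝ (strip ρ) := by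
  rw [strip_eq_prod]
  exact uniqueDiffOn_univ.prod (uniqueDiffOn_Icc (by linarith))

theorem strip_subset_closure_interior (hρ : 0 < ρ) : strip ρ ⊆ closure (interior (strip ρ)) := by
  rw [strip_eq_prod, interior_prod_eq, closure_prod_eq, interior_univ, closure_univ, interior_Icc,
    closure_Ioo (by linarith)]

theorem SmoothOn.differentiableWithinAt (hf : SmoothOn ρ f) (hp : p ∈ strip ρ) :
    DifferentiableWithinAt ℝ f (strip ρ) p :=
  (hf p hp).differentiableWithinAt (by simp)

theorem SmoothOn.continuousOn (hf : SmoothOn ρ f) : ContinuousOn f (strip ρ) :=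
  ContDiffOn.continuousOn hf

theorem SmoothOn.fderivWithin (hρ : 0 < ρ) (hf : SmoothOn ρ f) :
    ContDiffOn ℝ ∞ (fderivWithin ℝ f (strip ρ)) (strip ρ) :=
  ContDiffOn.fderivWithin hf (uniqueDiffOn_strip hρ) (by simp)

theorem SmoothOn.pd (hρ : 0 < ρ) (hf : SmoothOn ρ f) (i : Fin 2) : SmoothOn ρ (pd ρ i f) :=
  (hf.fderivWithin hρ).clm_apply contDiffOn_const

theorem SmoothOn.const (c : ℝ) : SmoothOn ρ (fun _ => c) := contDiffOn_const

theorem SmoothOn.add (hf : SmoothOn ρ f) (hh : SmoothOn ρ h) : SmoothOn ρ (fun q => f q + h q) :=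
  ContDiffOn.add hf hh

theorem SmoothOn.sub (hf : SmoothOn ρ f) (hh : SmoothOn ρ h) : SmoothOn ρ (fun q => f q - h q) :=
  ContDiffOn.sub hf hh

theorem SmoothOn.mul (hf : SmoothOn ρ f) (hh : SmoothOn ρ h) : SmoothOn ρ (fun q => f q * h q) :=
  ContDiffOn.mul hf hh

theorem SmoothOn.div (hf : SmoothOn ρ f) (hh : SmoothOn ρ h) (h0 : ∀ q ∈ strip ρ, h q ≠ 0) :
    SmoothOn ρ (fun q => f q / h q) :=
  ContDiffOn.div hf hh h0

theorem SmoothOn.sum {ι : Type*} {s : Finset ι} {F : ι → ℝ × ℝ → ℝ}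
    (hF : ∀ i ∈ s, SmoothOn ρ (F i)) : SmoothOn ρ (fun q => ∑ i ∈ s, F i q) :=
  ContDiffOn.sum hF

theorem SmoothOn.sqrt (hf : SmoothOn ρ f) (h0 : ∀ q ∈ strip ρ, f q ≠ 0) :
    SmoothOn ρ (fun q => √(f q)) :=
  ContDiffOn.sqrt hf h0

section Rules

variable (i j : Fin 2)

theorem pd_congr (hfh : Set.EqOn f h (strip ρ)) (hp : p ∈ strip ρ) : pd ρ i f p = pd ρ i h p := by
  rw [pd, pd, fderivWithin_congr hfh (hfh hp)]

theorem pd_add (hρ : 0 < ρ) (hf : SmoothOn ρ f) (hh : SmoothOn ρ h) (hp : p ∈ strip ρ) :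
    pd ρ i (fun q => f q + h q) p = pd ρ i f p + pd ρ i h p := by
  simp [pd, fderivWithin_fun_add (uniqueDiffOn_strip hρ p hp) (hf.differentiableWithinAt hp)
    (hh.differentiableWithinAt hp)]

theorem pd_sub (hρ : 0 < ρ) (hf : SmoothOn ρ f) (hh : SmoothOn ρ h) (hp : p ∈ strip ρ) :
    pd ρ i (fun q => f q - h q) p = pd ρ i f p - pd ρ i h p := by
  simp [pd, fderivWithin_fun_sub (uniqueDiffOn_strip hρ p hp) (hf.differentiableWithinAt hp)
    (hh.differentiableWithinAt hp)]

theorem pd_mul (hρ : 0 < ρ) (hf : SmoothOn ρ f) (hh : SmoothOn ρ h) (hp : p ∈ strip ρ) :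
    pd ρ i (fun q => f q * h q) p = f p * pd ρ i h p + h p * pd ρ i f p := by
  simp [pd, fderivWithin_fun_mul (uniqueDiffOn_strip hρ p hp) (hf.differentiableWithinAt hp)
    (hh.differentiableWithinAt hp)]

theorem pd_const (c : ℝ) : pd ρ i (fun _ => c) p = 0 := by
  simp [pd]

theorem pd_sum (hρ : 0 < ρ) {ι : Type*} {s : Finset ι} {F : ι → ℝ × ℝ → ℝ}
    (hF : ∀ k ∈ s, SmoothOn ρ (F k)) (hp : p ∈ strip ρ) :
    pd ρ i (fun q => ∑ k ∈ s, F k q) p = ∑ k ∈ s, pd ρ i (F k) p := by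
  simp [pd, fderivWithin_fun_sum (uniqueDiffOn_strip hρ p hp)
    (fun k hk => (hF k hk).differentiableWithinAt hp)]

/-- Product rule applied to `(f / h) * h = f`; `pd_sqrt` treats `√f * √f = f` the same way. -/
theorem pd_div (hρ : 0 < ρ) (hf : SmoothOn ρ f) (hh : SmoothOn ρ h)
    (h0 : ∀ q ∈ strip ρ, h q ≠ 0) (hp : p ∈ strip ρ) :
    pd ρ i (fun q => f q / h q) p = (pd ρ i f p * h p - f p * pd ρ i h p) / h p ^ 2 := by
  have key := pd_mul i hρ (hf.div hh h0) hh hp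
  rw [pd_congr (h := f) i (fun q hq => div_mul_cancel₀ (f q) (h0 q hq)) hp] at key
  have := h0 p hp
  rw [key]
  field_simp
  ring

theorem pd_sqrt (hρ : 0 < ρ) (hf : SmoothOn ρ f) (h0 : ∀ q ∈ strip ρ, 0 < f q)
    (hp : p ∈ strip ρ) :
    pd ρ i (fun q => √(f q)) p = pd ρ i f p / (2 * √(f p)) := by
  have hs := hf.sqrt (fun q hq => (h0 q hq).ne')
  have key := pd_mul i hρ hs hs hp
  rw [pd_congr (h := f) i (fun q hq => Real.mul_self_sqrt (h0 q hq).le) hp] at key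
  have : √(f p) ≠ 0 := (Real.sqrt_pos.2 (h0 p hp)).ne'
  rw [key]
  field_simp
  ring

/-- Symmetry extends to boundary points because the strip lies in the closure of its interior. -/
theorem pd_comm (hρ : 0 < ρ) (hf : SmoothOn ρ f) (hp : p ∈ strip ρ) :
    pd ρ i (pd ρ j f) p = pd ρ j (pd ρ i f) p := by
  have hsymm : IsSymmSndFDerivWithinAt ℝ f (strip ρ) p :=
    ContDiffWithinAt.isSymmSndFDerivWithinAt (hf p hp)
      (by simpa using WithTop.coe_le_coe.2 (le_top : (2 : ℕ∞) ≤ ⊤)) (uniqueDiffOn_strip hρ) (strip_subset_closure_interior hρ hp) hp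
  have key : ∀ a b, pd ρ a (pd ρ b f) p =
      fderivWithin ℝ (fderivWithin ℝ f (strip ρ)) (strip ρ) p (basisVec a) (basisVec b) := by
    intro a b
    change fderivWithin ℝ (fun q => fderivWithin ℝ f (strip ρ) q (basisVec b)) (strip ρ) p _ = _
    rw [fderivWithin_clm_apply (uniqueDiffOn_strip hρ p hp)
      (((hf.fderivWithin hρ) p hp).differentiableWithinAt (by simp))
      (differentiableWithinAt_const _)]
    simp
  rw [key, key, hsymm.eq]

open scoped Pointwise in
theorem pd_periodic (hf : ∀ q ∈ strip ρ, f (q.1 + 2 * Real.pi, q.2) = f q) (hp : p ∈ strip ρ) :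
    pd ρ i f (p.1 + 2 * Real.pi, p.2) = pd ρ i f p := by
  have hset : ((2 * Real.pi, 0) : ℝ × ℝ) +ᵥ strip ρ = strip ρ := by
    ext q
    rw [Set.mem_vadd_set_iff_neg_vadd_mem]
    simp [strip]
  have hadd : ∀ q : ℝ × ℝ, q + (2 * Real.pi, 0) = (q.1 + 2 * Real.pi, q.2) := fun q => by
    ext <;> simp
  have key := fderivWithin_comp_add_right (𝕜 := ℝ) (f := f) (s := strip ρ) (x := p)
    ((2 * Real.pi, 0) : ℝ × ℝ)
  simp only [hset, hadd] at key
  rw [pd, pd, ← key, fderivWithin_congr hf (hf p hp)]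

end Rules

/-! ### Metric, inverse metric and curvature in coordinates: regularity and periodicity. -/

theorem IsMetric.symm (hg : IsMetric ρ g) (hp : p ∈ strip ρ) : g p 1 0 = g p 0 1 := by
  simpa using ((hg.posDef p hp).isHermitian.apply 0 1)

theorem IsMetric.pos_zero_zero (hg : IsMetric ρ g) (hp : p ∈ strip ρ) : 0 < g p 0 0 := (hg.posDef p hp).diag_pos

theorem IsMetric.det_pos (hg : IsMetric ρ g) (hp : p ∈ strip ρ) : 0 < (g p).det := (hg.posDef p hp).det_pos

theorem IsMetric.det_eq (hg : IsMetric ρ g) (hp : p ∈ strip ρ) : (g p).det = g p 0 0 * g p 1 1 - g p 0 1 * g p 0 1 := by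
  rw [Matrix.det_fin_two, hg.symm hp]

theorem inv_zero_zero (g : MetricField) (p : ℝ × ℝ) : (g p)⁻¹ 0 0 = g p 1 1 / (g p).det := by
  simp [Matrix.inv_def, Matrix.adjugate_fin_two, div_eq_inv_mul]

theorem inv_one_one (g : MetricField) (p : ℝ × ℝ) : (g p)⁻¹ 1 1 = g p 0 0 / (g p).det := by
  simp [Matrix.inv_def, Matrix.adjugate_fin_two, div_eq_inv_mul]

theorem inv_zero_one (g : MetricField) (p : ℝ × ℝ) : (g p)⁻¹ 0 1 = (0 - g p 0 1) / (g p).det := by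
  simp [Matrix.inv_def, Matrix.adjugate_fin_two, div_eq_inv_mul]

theorem inv_one_zero (g : MetricField) (p : ℝ × ℝ) : (g p)⁻¹ 1 0 = (0 - g p 1 0) / (g p).det := by
  simp [Matrix.inv_def, Matrix.adjugate_fin_two, div_eq_inv_mul]

theorem IsMetric.smoothOn (hg : IsMetric ρ g) (i j : Fin 2) : SmoothOn ρ (fun q => g q i j) :=
  hg.smooth i j

theorem IsMetric.smoothOn_det (hg : IsMetric ρ g) : SmoothOn ρ (fun q => (g q).det) := by
  simp only [Matrix.det_fin_two]
  exact ((hg.smoothOn 0 0).mul (hg.smoothOn 1 1)).sub ((hg.smoothOn 0 1).mul (hg.smoothOn 1 0))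

theorem IsMetric.smoothOn_inv (hg : IsMetric ρ g) (i j : Fin 2) :
    SmoothOn ρ (fun q => (g q)⁻¹ i j) := by
  have hD : ∀ q ∈ strip ρ, (g q).det ≠ 0 := fun q hq => (hg.det_pos hq).ne'
  match i, j with
  | 0, 0 => simpa only [inv_zero_zero] using (hg.smoothOn 1 1).div hg.smoothOn_det hD
  | 0, 1 => simpa only [inv_zero_one] using
      ((SmoothOn.const 0).sub (hg.smoothOn 0 1)).div hg.smoothOn_det hD
  | 1, 0 => simpa only [inv_one_zero] using
      ((SmoothOn.const 0).sub (hg.smoothOn 1 0)).div hg.smoothOn_det hD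
  | 1, 1 => simpa only [inv_one_one] using (hg.smoothOn 0 0).div hg.smoothOn_det hD

theorem IsMetric.smoothOn_christoffel (hρ : 0 < ρ) (hg : IsMetric ρ g) (k i j : Fin 2) :
    SmoothOn ρ (christoffel ρ g k i j) :=
  (SmoothOn.const _).mul (SmoothOn.sum fun l _ => (hg.smoothOn_inv k l).mul
    ((((hg.smoothOn j l).pd hρ i).add ((hg.smoothOn i l).pd hρ j)).sub
      ((hg.smoothOn i j).pd hρ l)))

theorem IsMetric.smoothOn_ricci (hρ : 0 < ρ) (hg : IsMetric ρ g) (i j : Fin 2) :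
    SmoothOn ρ (ricci ρ g i j) := by
  have hΓ := hg.smoothOn_christoffel hρ
  exact SmoothOn.sum fun k _ => (((hΓ k i j).pd hρ k).sub ((hΓ k i k).pd hρ j)).add
    (SmoothOn.sum fun l _ => ((hΓ k k l).mul (hΓ l i j)).sub ((hΓ k j l).mul (hΓ l i k)))

theorem IsMetric.smoothOn_scalarCurvature (hρ : 0 < ρ) (hg : IsMetric ρ g) :
    SmoothOn ρ (scalarCurvature ρ g) :=
  SmoothOn.sum fun i _ => SmoothOn.sum fun j _ => (hg.smoothOn_inv i j).mul
    (hg.smoothOn_ricci hρ i j)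

theorem IsMetric.christoffel_periodic (hg : IsMetric ρ g) (k i j : Fin 2) (hp : p ∈ strip ρ) :
    christoffel ρ g k i j (p.1 + 2 * Real.pi, p.2) = christoffel ρ g k i j p := by
  have h1 : ∀ m a b, pd ρ m (fun q => g q a b) (p.1 + 2 * Real.pi, p.2)
      = pd ρ m (fun q => g q a b) p :=
    fun m a b => pd_periodic m (fun q hq => by rw [hg.periodic q hq]) hp
  simp only [christoffel, h1, hg.periodic p hp]

theorem IsMetric.scalarCurvature_periodic (hg : IsMetric ρ g) (hp : p ∈ strip ρ) :
    scalarCurvature ρ g (p.1 + 2 * Real.pi, p.2) = scalarCurvature ρ g p := by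
  have h1 : ∀ m k a b, pd ρ m (christoffel ρ g k a b) (p.1 + 2 * Real.pi, p.2)
      = pd ρ m (christoffel ρ g k a b) p :=
    fun m k a b => pd_periodic m (fun q hq => hg.christoffel_periodic k a b hq) hp
  simp only [scalarCurvature, ricci, h1, hg.periodic p hp, hg.christoffel_periodic _ _ _ hp]

theorem IsMetric.pd_christoffel (hρ : 0 < ρ) (hg : IsMetric ρ g) (m k i j : Fin 2)
    (hp : p ∈ strip ρ) :
    pd ρ m (christoffel ρ g k i j) p = (1 / 2) * ∑ l,
      ((g p)⁻¹ k l * (pd ρ m (pd ρ i (fun q => g q j l)) p + pd ρ m (pd ρ j (fun q => g q i l)) p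
        - pd ρ m (pd ρ l (fun q => g q i j)) p)
      + (pd ρ i (fun q => g q j l) p + pd ρ j (fun q => g q i l) p - pd ρ l (fun q => g q i j) p)
        * pd ρ m (fun q => (g q)⁻¹ k l) p) := by
  have h1 : ∀ a b c, SmoothOn ρ (pd ρ a (fun q => g q b c)) := fun a b c => (hg.smoothOn b c).pd hρ a
  have h2 := hg.smoothOn_inv
  have h3 : ∀ l, SmoothOn ρ (fun q => pd ρ i (fun q => g q j l) q + pd ρ j (fun q => g q i l) q
      - pd ρ l (fun q => g q i j) q) := fun l => ((h1 _ _ _).add (h1 _ _ _)).sub (h1 _ _ _)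
  unfold christoffel
  rw [pd_mul m hρ (SmoothOn.const _) (SmoothOn.sum fun l _ => (h2 k l).mul (h3 l)) hp,
    pd_const, mul_zero, add_zero, pd_sum m hρ (fun l _ => (h2 k l).mul (h3 l)) hp]
  congr 1
  refine Finset.sum_congr rfl fun l _ => ?_
  rw [pd_mul m hρ (h2 k l) (h3 l) hp, pd_sub m hρ ((h1 _ _ _).add (h1 _ _ _)) (h1 _ _ _) hp,
    pd_add m hρ (h1 _ _ _) (h1 _ _ _) hp]

theorem IsMetric.pd_det (hρ : 0 < ρ) (hg : IsMetric ρ g) (m : Fin 2) (hp : p ∈ strip ρ) :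
    pd ρ m (fun q => (g q).det) p = g p 0 0 * pd ρ m (fun q => g q 1 1) p
      + g p 1 1 * pd ρ m (fun q => g q 0 0) p
      - (g p 0 1 * pd ρ m (fun q => g q 1 0) p + g p 1 0 * pd ρ m (fun q => g q 0 1) p) := by
  simp only [Matrix.det_fin_two]
  rw [pd_sub m hρ ((hg.smoothOn 0 0).mul (hg.smoothOn 1 1))
    ((hg.smoothOn 0 1).mul (hg.smoothOn 1 0)) hp, pd_mul m hρ (hg.smoothOn 0 0) (hg.smoothOn 1 1) hp,
    pd_mul m hρ (hg.smoothOn 0 1) (hg.smoothOn 1 0) hp]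

/-! ### Connection form and Liouville's formula. -/

/-- The coefficient of `dx^i` in the connection form of the orthonormal frame obtained from
`∂_θ, ∂_s`. -/
def connectionForm (ρ : ℝ) (g : MetricField) (i : Fin 2) (p : ℝ × ℝ) : ℝ :=
  √((g p).det) * christoffel ρ g 1 0 i p / g p 0 0

theorem IsMetric.smoothOn_volume (hg : IsMetric ρ g) : SmoothOn ρ (fun q => √((g q).det)) :=
  hg.smoothOn_det.sqrt fun _ hq => (hg.det_pos hq).ne'

theorem IsMetric.smoothOn_connectionForm (hρ : 0 < ρ) (hg : IsMetric ρ g) (i : Fin 2) :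
    SmoothOn ρ (connectionForm ρ g i) :=
  (hg.smoothOn_volume.mul (hg.smoothOn_christoffel hρ 1 0 i)).div
    (hg.smoothOn 0 0) fun _ hq => (hg.pos_zero_zero hq).ne'

theorem IsMetric.pd_connectionForm (hρ : 0 < ρ) (hg : IsMetric ρ g) (m i : Fin 2)
    (hp : p ∈ strip ρ) :
    pd ρ m (connectionForm ρ g i) p = √((g p).det) *
      ((pd ρ m (christoffel ρ g 1 0 i) p
        + christoffel ρ g 1 0 i p * (pd ρ m (fun q => (g q).det) p / (2 * (g p).det))) * g p 0 0
        - christoffel ρ g 1 0 i p * pd ρ m (fun q => g q 0 0) p) / g p 0 0 ^ 2 := by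
  have hW := hg.smoothOn_volume
  have hΓ := hg.smoothOn_christoffel hρ 1 0 i
  unfold connectionForm
  rw [pd_div m hρ (hW.mul hΓ) (hg.smoothOn 0 0) (fun _ hq => (hg.pos_zero_zero hq).ne') hp,
    pd_mul m hρ hW hΓ hp, pd_sqrt m hρ hg.smoothOn_det (fun _ hq => hg.det_pos hq) hp]
  congr 1
  have h0 := hg.det_pos hp
  have h1 : √((g p).det) ≠ 0 := (Real.sqrt_pos.2 h0).ne'
  have h2 : (g p).det = √((g p).det) ^ 2 := (Real.sq_sqrt h0.le).symm
  generalize √((g p).det) = w at *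
  rw [h2]
  field_simp

/-- Liouville's formula: the curvature form is the exterior derivative of the connection form. -/
theorem IsMetric.scalarCurvature_mul_volume (hρ : 0 < ρ) (hg : IsMetric ρ g) (hp : p ∈ strip ρ) :
    scalarCurvature ρ g p * √((g p).det)
      = 2 * (pd ρ 1 (connectionForm ρ g 0) p - pd ρ 0 (connectionForm ρ g 1) p) := by
  have hD := (hg.det_pos hp).ne'
  have hE := (hg.pos_zero_zero hp).ne'
  have hDn : ∀ q ∈ strip ρ, (g q).det ≠ 0 := fun q hq => (hg.det_pos hq).ne'
  have hz : SmoothOn ρ (fun _ => 0) := SmoothOn.const 0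
  have i00 := fun m => pd_div m hρ (hg.smoothOn 1 1) hg.smoothOn_det hDn hp
  have i11 := fun m => pd_div m hρ (hg.smoothOn 0 0) hg.smoothOn_det hDn hp
  have i01 := fun m => pd_div m hρ (hz.sub (hg.smoothOn 0 1)) hg.smoothOn_det hDn hp
  have i10 := fun m => pd_div m hρ (hz.sub (hg.smoothOn 1 0)) hg.smoothOn_det hDn hp
  have n01 := fun m => pd_sub m hρ hz (hg.smoothOn 0 1) hp
  have n10 := fun m => pd_sub m hρ hz (hg.smoothOn 1 0) hp
  have s1 : ∀ m, Set.EqOn (pd ρ m (fun q => g q 1 0)) (pd ρ m (fun q => g q 0 1)) (strip ρ) :=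
    fun m q hq => pd_congr m (fun r hr => hg.symm hr) hq
  have s2 : ∀ m l, pd ρ l (pd ρ m (fun q => g q 1 0)) p = pd ρ l (pd ρ m (fun q => g q 0 1)) p :=
    fun m l => pd_congr l (s1 m) hp
  have c : ∀ a b, pd ρ 1 (pd ρ 0 (fun q => g q a b)) p = pd ρ 0 (pd ρ 1 (fun q => g q a b)) p :=
    fun a b => pd_comm 1 0 hρ (hg.smoothOn a b) hp
  rw [hg.pd_connectionForm hρ _ _ hp, hg.pd_connectionForm hρ _ _ hp]
  simp only [scalarCurvature, ricci, hg.pd_christoffel hρ _ _ _ _ hp, christoffel,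
    Fin.sum_univ_two, i00, i01, i10, i11, n01, n10, s1 _ hp, s2, c, hg.pd_det hρ _ hp, pd_const,
    inv_zero_zero, inv_one_one, inv_zero_one, inv_one_zero, hg.symm hp]
  -- Eliminating `g p 1 1` in favour of the determinant leaves the entries and their derivatives as
  -- independent variables. Both sides are linear in `√det`, so a rational identity in these
  -- variables remains.
  have hdet : g p 1 1 = ((g p).det + g p 0 1 ^ 2) / g p 0 0 := by
    rw [hg.det_eq hp]
    field_simp
    ring
  rw [hdet]
  clear hdet i00 i11 i01 i10 n01 n10 s1 s2 c hDn hz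
  generalize √((g p).det) = w at *
  generalize (g p).det = d at *
  generalize g p 0 0 = e at *
  generalize g p 0 1 = f at *
  generalize pd ρ 0 (pd ρ 0 (fun q => g q 0 0)) p = e00 at *
  generalize pd ρ 0 (pd ρ 1 (fun q => g q 0 0)) p = e01 at *
  generalize pd ρ 1 (pd ρ 1 (fun q => g q 0 0)) p = e11 at *
  generalize pd ρ 0 (pd ρ 0 (fun q => g q 0 1)) p = f00 at *
  generalize pd ρ 0 (pd ρ 1 (fun q => g q 0 1)) p = f01 at *
  generalize pd ρ 1 (pd ρ 1 (fun q => g q 0 1)) p = f11 at *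
  generalize pd ρ 0 (pd ρ 0 (fun q => g q 1 1)) p = h00 at *
  generalize pd ρ 0 (pd ρ 1 (fun q => g q 1 1)) p = h01 at *
  generalize pd ρ 1 (pd ρ 1 (fun q => g q 1 1)) p = h11 at *
  generalize pd ρ 0 (fun q => g q 0 0) p = e0 at *
  generalize pd ρ 1 (fun q => g q 0 0) p = e1 at *
  generalize pd ρ 0 (fun q => g q 0 1) p = f0 at *
  generalize pd ρ 1 (fun q => g q 0 1) p = f1 at *
  generalize pd ρ 0 (fun q => g q 1 1) p = h0 at *
  generalize pd ρ 1 (fun q => g q 1 1) p = h1 at *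
  field_simp
  ring

/-! ### Integration over the fundamental cell and Gauss–Bonnet. -/

theorem cell_eq_Icc : cell ρ = Set.Icc ((0, -ρ) : ℝ × ℝ) (2 * Real.pi, ρ) := by
  rw [cell, Set.Icc_prod_eq]

theorem isCompact_cell : IsCompact (cell ρ) := isCompact_Icc.prod isCompact_Icc

theorem measurableSet_cell : MeasurableSet (cell ρ) := isCompact_cell.measurableSet

theorem cell_subset_strip : cell ρ ⊆ strip ρ := fun _ hp => hp.2

theorem bdry_subset_strip (hρ : 0 < ρ) : bdry ρ ⊆ strip ρ := by
  rintro p (hp | hp) <;> simp only [strip, Set.mem_ofPred_eq, hp] <;> constructor <;> linarith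

theorem integrableOn_cell (hf : ContinuousOn f (strip ρ)) : IntegrableOn f (cell ρ) :=
  (hf.mono cell_subset_strip).integrableOn_compact isCompact_cell

theorem integrableOn_cell_mul_volume (hg : IsMetric ρ g) (hf : ContinuousOn f (strip ρ)) :
    IntegrableOn (fun p => f p * √((g p).det)) (cell ρ) :=
  integrableOn_cell (hf.mul hg.smoothOn_volume.continuousOn)

/-- The normal is a multiple of `∇s`, so pairing with it only sees the `s`-component `Γ^1_{00}` of
`∇_{∂_θ} ∂_θ`. -/
theorem IsMetric.geodesicCurvature_mul_length (hg : IsMetric ρ g) (hp : p ∈ strip ρ) :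
    geodesicCurvature ρ g p * √(g p 0 0) = -Real.sign p.2 * connectionForm ρ g 0 p := by
  have hD := hg.det_pos hp
  have hE := hg.pos_zero_zero hp
  have hd := hg.det_eq hp
  simp only [geodesicCurvature, inwardNormal, connectionForm, Fin.sum_univ_two, inv_zero_one,
    inv_one_one, hg.symm hp, Real.sqrt_div hE.le]
  have h1 : √(g p 0 0) ≠ 0 := (Real.sqrt_pos.2 hE).ne'
  have h2 : √((g p).det) ≠ 0 := (Real.sqrt_pos.2 hD).ne'
  have h3 := Real.sq_sqrt hE.le
  have h4 := Real.sq_sqrt hD.le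
  have hD' := hD.ne'
  have hE' := hE.ne'
  field_simp
  rw [hd]
  ring

/-- Periodicity of `f` cancels the sides `θ = 0` and `θ = 2π`; only the boundary circles remain. -/
theorem integral_divergence_strip (hρ : 0 < ρ) (hf : SmoothOn ρ f) (hh : SmoothOn ρ h)
    (hper : ∀ q ∈ strip ρ, f (q.1 + 2 * Real.pi, q.2) = f q) :
    ∫ p in cell ρ, (pd ρ 0 f p + pd ρ 1 h p) =
      (∫ θ in (0 : ℝ)..2 * Real.pi, h (θ, ρ)) - ∫ θ in (0 : ℝ)..2 * Real.pi, h (θ, -ρ) := by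
  have hnhds : ∀ x ∈ Set.Ioo (0 : ℝ) (2 * Real.pi) ×ˢ Set.Ioo (-ρ) ρ, strip ρ ∈ nhds x := by
    intro x hx
    rw [strip_eq_prod, ← mem_interior_iff_mem_nhds, interior_prod_eq, interior_univ, interior_Icc]
    exact ⟨trivial, hx.2⟩
  have hder : ∀ {u : ℝ × ℝ → ℝ}, SmoothOn ρ u →
      ∀ x ∈ Set.Ioo (0 : ℝ) (2 * Real.pi) ×ˢ Set.Ioo (-ρ) ρ,
        HasFDerivAt u (fderivWithin ℝ u (strip ρ) x) x := fun hu x hx =>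
    (hu.differentiableWithinAt (Set.Ioo_subset_Icc_self hx.2)).hasFDerivWithinAt.hasFDerivAt
      (hnhds x hx)
  have hc : ∀ {u : ℝ × ℝ → ℝ}, SmoothOn ρ u →
      ContinuousOn u (Set.Icc ((0, -ρ) : ℝ × ℝ) (2 * Real.pi, ρ)) := fun hu => by
    rw [← cell_eq_Icc]; exact hu.continuousOn.mono cell_subset_strip
  have hi := integrableOn_cell ((hf.pd hρ 0).add (hh.pd hρ 1)).continuousOn
  rw [cell_eq_Icc] at hi
  have key := integral_divergence_prod_Icc_of_hasFDerivAt_of_le f h _ _ ((0, -ρ) : ℝ × ℝ)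
    (2 * Real.pi, ρ) ⟨by positivity, by simp [hρ.le]⟩ (hc hf) (hc hh) (hder hf) (hder hh)
    (by simpa [pd, basisVec] using hi)
  have hpe : ∫ y in (-ρ)..ρ, f (2 * Real.pi, y) = ∫ y in (-ρ)..ρ, f (0, y) := by
    refine intervalIntegral.integral_congr fun y hy => ?_
    rw [Set.uIcc_of_le (by linarith)] at hy
    simpa using hper (0, y) hy
  rw [cell_eq_Icc]
  simp only [pd, basisVec, if_true, one_ne_zero, if_false]
  rw [key, hpe]
  ring

/-- The Gauss–Bonnet theorem on the cylinder, whose Euler characteristic is zero. -/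
theorem IsMetric.gauss_bonnet (hρ : 0 < ρ) (hg : IsMetric ρ g) :
    integralM ρ g (scalarCurvature ρ g) =
      -2 * ((∫ θ in (0 : ℝ)..2 * Real.pi, geodesicCurvature ρ g (θ, ρ) * √(g (θ, ρ) 0 0)) +
        ∫ θ in (0 : ℝ)..2 * Real.pi, geodesicCurvature ρ g (θ, -ρ) * √(g (θ, -ρ) 0 0)) := by
  have hρ1 : ∀ θ : ℝ, (θ, ρ) ∈ strip ρ := fun θ => bdry_subset_strip hρ (Or.inl rfl)
  have hρ2 : ∀ θ : ℝ, (θ, -ρ) ∈ strip ρ := fun θ => bdry_subset_strip hρ (Or.inr rfl)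
  -- The field `(-ω₁, ω₀)` has divergence `∂₁ω₀ - ∂₀ω₁`, half the density of `R dA`.
  have hdiv := integral_divergence_strip hρ
    ((SmoothOn.const (-1)).mul (hg.smoothOn_connectionForm hρ 1)) (hg.smoothOn_connectionForm hρ 0)
    (fun q hq => by
      simp only [connectionForm, hg.periodic q hq, hg.christoffel_periodic _ _ _ hq])
  have hint : integralM ρ g (scalarCurvature ρ g) = 2 * ∫ p in cell ρ,
      (pd ρ 0 (fun q => -1 * connectionForm ρ g 1 q) p + pd ρ 1 (connectionForm ρ g 0) p) := by
    rw [integralM, ← integral_const_mul]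
    refine setIntegral_congr_fun measurableSet_cell fun p hp => ?_
    have hp' := cell_subset_strip hp
    simp only [hg.scalarCurvature_mul_volume hρ hp',
      pd_mul 0 hρ (SmoothOn.const (-1)) (hg.smoothOn_connectionForm hρ 1) hp', pd_const]
    ring
  rw [hint, hdiv]
  simp only [hg.geodesicCurvature_mul_length (hρ1 _), hg.geodesicCurvature_mul_length (hρ2 _),
    Real.sign_of_pos hρ, Real.sign_of_neg (neg_lt_zero.2 hρ), intervalIntegral.integral_neg,
    neg_mul, one_mul, neg_neg]
  ring

/-! ### Total curvature against area, maximum and `L²` norm of the curvature. -/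

theorem IsMetric.area_pos (hρ : 0 < ρ) (hg : IsMetric ρ g) : 0 < area ρ g := by
  have hv : 0 < volume (cell ρ) := by
    rw [cell, Measure.volume_eq_prod, Measure.prod_prod, Real.volume_Icc, Real.volume_Icc]
    have := Real.pi_pos
    exact ENNReal.mul_pos (by simp [this]) (by simp; linarith)
  rw [area, integralM, setIntegral_pos_iff_support_of_nonneg_ae]
  · refine hv.trans_le (measure_mono fun p hp => ⟨?_, hp⟩)
    have := hg.det_pos (cell_subset_strip hp)
    simp [(Real.sqrt_pos.2 this).ne']
  · exact Filter.Eventually.of_forall fun p => by simp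
  · exact integrableOn_cell_mul_volume hg continuousOn_const

/-- The strip is not compact, but periodicity moves every point into `cell`. Boundedness makes the
`sSup` in `scalarMax` a genuine supremum. -/
theorem IsMetric.bddAbove_scalarCurvature (hρ : 0 < ρ) (hg : IsMetric ρ g) :
    BddAbove (scalarCurvature ρ g '' strip ρ) := by
  obtain ⟨B, hB⟩ := isCompact_cell.bddAbove_image
    ((hg.smoothOn_scalarCurvature hρ).continuousOn.mono cell_subset_strip)
  refine ⟨B, ?_⟩
  rintro _ ⟨p, hp, rfl⟩
  have hper : Function.Periodic (fun θ => scalarCurvature ρ g (θ, p.2)) (2 * Real.pi) :=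
    fun θ => hg.scalarCurvature_periodic (p := (θ, p.2)) hp
  obtain ⟨y, hy, hxy⟩ := hper.exists_mem_Ico₀ Real.two_pi_pos p.1
  change scalarCurvature ρ g (p.1, p.2) ≤ B
  rw [show scalarCurvature ρ g (p.1, p.2) = scalarCurvature ρ g (y, p.2) from hxy]
  exact hB ⟨(y, p.2), ⟨Set.Ico_subset_Icc_self hy, hp⟩, rfl⟩

theorem IsMetric.integralM_scalarCurvature_le (hρ : 0 < ρ) (hg : IsMetric ρ g) :
    integralM ρ g (scalarCurvature ρ g) ≤ scalarMax ρ g * area ρ g := by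
  rw [area, integralM, integralM, ← integral_const_mul]
  refine setIntegral_mono_on
    (integrableOn_cell_mul_volume hg (hg.smoothOn_scalarCurvature hρ).continuousOn)
    ((integrableOn_cell_mul_volume hg continuousOn_const).const_mul _) measurableSet_cell
    fun p hp => ?_
  rw [one_mul]
  exact mul_le_mul_of_nonneg_right (le_csSup (hg.bddAbove_scalarCurvature hρ)
    ⟨p, cell_subset_strip hp, rfl⟩) (Real.sqrt_nonneg _)

/-- The Cauchy–Schwarz inequality for the scalar curvature. -/
theorem IsMetric.integralM_scalarCurvature_sq_le (hρ : 0 < ρ) (hg : IsMetric ρ g) :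
    integralM ρ g (scalarCurvature ρ g) ^ 2 ≤
      area ρ g * integralM ρ g (fun p => scalarCurvature ρ g p ^ 2) := by
  have hR := (hg.smoothOn_scalarCurvature hρ).continuousOn
  have hA := hg.area_pos hρ
  have h1 := integrableOn_cell_mul_volume hg hR
  have h2 := integrableOn_cell_mul_volume hg (f := fun p => scalarCurvature ρ g p ^ 2) (hR.pow 2)
  have h0 := integrableOn_cell_mul_volume hg (f := fun _ => 1) continuousOn_const
  have hexp : ∀ a b : ℝ, integralM ρ g (fun p => (a * scalarCurvature ρ g p - b) ^ 2)
      = a ^ 2 * integralM ρ g (fun p => scalarCurvature ρ g p ^ 2)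
        - 2 * a * b * integralM ρ g (scalarCurvature ρ g) + b ^ 2 * area ρ g := by
    intro a b
    simp only [area, integralM]
    have h3 : IntegrableOn (fun p => a ^ 2 * (scalarCurvature ρ g p ^ 2 * √((g p).det))
        - 2 * a * b * (scalarCurvature ρ g p * √((g p).det))) (cell ρ) :=
      (h2.const_mul _).sub (h1.const_mul _)
    rw [← integral_const_mul, ← integral_const_mul, ← integral_const_mul,
      ← integral_sub (h2.const_mul _) (h1.const_mul _), ← integral_add h3 (h0.const_mul _)]
    refine integral_congr_ae (Filter.Eventually.of_forall fun p => ?_)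
    simp only
    ring
  -- With `I = ∫ R dA`, expanding `∫ (A R - I)² dA ≥ 0` gives `A (A ∫ R² dA - I²) ≥ 0`.
  have key : 0 ≤ integralM ρ g
      (fun p => (area ρ g * scalarCurvature ρ g p - integralM ρ g (scalarCurvature ρ g)) ^ 2) :=
    setIntegral_nonneg measurableSet_cell fun p _ => by positivity
  rw [hexp] at key
  have : 0 ≤ area ρ g * (area ρ g * integralM ρ g (fun p => scalarCurvature ρ g p ^ 2)
      - integralM ρ g (scalarCurvature ρ g) ^ 2) := by
    linarith
  linarith [nonneg_of_mul_nonneg_right this hA]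

/-! ### Evolution of volume and area under the flow. -/

theorem geodesicCurvature_congr {g' : MetricField} (h : ∀ q ∈ strip ρ, g q = g' q)
    (hp : p ∈ strip ρ) : geodesicCurvature ρ g p = geodesicCurvature ρ g' p := by
  have h1 : ∀ m a b, pd ρ m (fun q => g q a b) p = pd ρ m (fun q => g' q a b) p :=
    fun m a b => pd_congr m (fun q hq => by simp only [h q hq]) hp
  simp only [geodesicCurvature, christoffel, inwardNormal, h1, h p hp]

theorem IsRicciFlow.geodesicCurvature_eq (hρ : 0 < ρ) (hflow : IsRicciFlow ρ T g₀ gt)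
    (ht : 0 ≤ t) (htT : (t : EReal) < T) (hp : p ∈ bdry ρ) :
    geodesicCurvature ρ (gt t) p = geodesicCurvature ρ g₀ p := by
  rcases ht.eq_or_lt with rfl | ht
  · exact geodesicCurvature_congr hflow.initial (bdry_subset_strip hρ hp)
  · exact hflow.boundary t ht htT p hp

theorem isOpen_posTime : IsOpen {t : ℝ | 0 < t ∧ (t : EReal) < T} :=
  (isOpen_lt continuous_const continuous_id).inter
    (isOpen_lt continuous_coe_real_ereal continuous_const)

theorem IsRicciFlow.hasDerivAt_volume (hflow : IsRicciFlow ρ T g₀ gt) (ht : 0 < t)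
    (htT : (t : EReal) < T) (hp : p ∈ strip ρ) :
    HasDerivAt (fun τ => √((gt τ p).det))
      (-(scalarCurvature ρ (gt t) p * √((gt t p).det))) t := by
  have hD := (hflow.metric t ht.le htT).det_pos hp
  have h := hflow.evolution t ht htT p hp
  have hdet : HasDerivAt (fun τ => (gt τ p).det)
      (-2 * scalarCurvature ρ (gt t) p * (gt t p).det) t := by
    simp only [Matrix.det_fin_two]
    convert! ((h 0 0).mul (h 1 1)).sub ((h 0 1).mul (h 1 0)) using 1
    ring
  convert! hdet.sqrt hD.ne' using 1
  have h1 : √((gt t p).det) ≠ 0 := (Real.sqrt_pos.2 hD).ne'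
  have h2 := Real.sq_sqrt hD.le
  field_simp
  rw [h2]

/-- The evolution equation transfers regularity in time and space to the scalar curvature. -/
theorem IsRicciFlow.continuousOn_scalarCurvature (hρ : 0 < ρ) (hflow : IsRicciFlow ρ T g₀ gt) :
    ContinuousOn (fun q : ℝ × (ℝ × ℝ) => scalarCurvature ρ (gt q.1) q.2)
      {q | 0 < q.1 ∧ (q.1 : EReal) < T ∧ q.2 ∈ strip ρ} := by
  set D : Set (ℝ × (ℝ × ℝ)) := {q | 0 < q.1 ∧ (q.1 : EReal) < T ∧ q.2 ∈ strip ρ} with hD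
  set F : ℝ × (ℝ × ℝ) → ℝ := fun q => gt q.1 q.2 0 0 with hF
  have hprod : D = {t : ℝ | 0 < t ∧ (t : EReal) < T} ×ˢ strip ρ := by
    ext q; simp [hD, and_assoc]
  have hu : UniqueDiffOn ℝ D := by
    rw [hprod]; exact isOpen_posTime.uniqueDiffOn.prod (uniqueDiffOn_strip hρ)
  have hsm : ContDiffOn ℝ ∞ F D := hflow.smooth 0 0
  have hder : ContinuousOn (fun q => fderivWithin ℝ F D q (1, 0)) D :=
    (hsm.continuousOn_fderivWithin hu (by simp)).clm_apply continuousOn_const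
  have hpos : ∀ q ∈ D, 0 < F q := fun q hq =>
    (hflow.metric q.1 hq.1.le hq.2.1).pos_zero_zero hq.2.2
  -- The `00` component of the evolution equation reads `R = -∂_t g₀₀ / g₀₀`, and the right side is
  -- jointly continuous.
  refine ((hder.neg).div hsm.continuousOn fun q hq => (hpos q hq).ne').congr ?_
  rintro ⟨t, p⟩ hq
  have h1 : HasDerivWithinAt (fun τ : ℝ => F (τ, p)) (fderivWithin ℝ F D (t, p) (1, 0))
      {t : ℝ | 0 < t ∧ (t : EReal) < T} t :=
    HasFDerivWithinAt.comp_hasDerivWithinAt (f := fun τ : ℝ => (τ, p)) t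
      ((hsm.differentiableOn (by simp) (t, p) hq).hasFDerivWithinAt)
      ((hasDerivWithinAt_id t _).prodMk (hasDerivWithinAt_const t _ p))
      (fun τ hτ => ⟨hτ.1, hτ.2, hq.2.2⟩)
  have h2 := h1.hasDerivAt (isOpen_posTime.mem_nhds ⟨hq.1, hq.2.1⟩)
  have h3 := h2.unique (hflow.evolution t hq.1 hq.2.1 p hq.2.2 0 0)
  have h4 := (hpos _ hq).ne'
  simp only [Pi.div_apply, Pi.neg_apply, h3]
  simp only [hF] at h4 ⊢
  field_simp

theorem IsRicciFlow.continuousOn_volume (hflow : IsRicciFlow ρ T g₀ gt) :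
    ContinuousOn (fun q : ℝ × (ℝ × ℝ) => √((gt q.1 q.2).det))
      {q | 0 ≤ q.1 ∧ (q.1 : EReal) < T ∧ q.2 ∈ strip ρ} := by
  have h := hflow.continuous
  simp only [Matrix.det_fin_two]
  exact (((h 0 0).mul (h 1 1)).sub ((h 0 1).mul (h 1 0))).sqrt

theorem IsRicciFlow.hasDerivAt_area (hρ : 0 < ρ) (hflow : IsRicciFlow ρ T g₀ gt) (ht : 0 < t)
    (htT : (t : EReal) < T) :
    HasDerivAt (fun τ => area ρ (gt τ)) (-integralM ρ (gt t) (scalarCurvature ρ (gt t))) t := by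
  obtain ⟨a, b, -, hab, hI⟩ :=
    exists_Icc_mem_subset_of_mem_nhds ((isOpen_posTime (T := T)).mem_nhds ⟨ht, htT⟩)
  have hK : IsCompact (Set.Icc a b ×ˢ cell ρ) := isCompact_Icc.prod isCompact_cell
  have hcont : ContinuousOn (fun q : ℝ × (ℝ × ℝ) =>
      -(scalarCurvature ρ (gt q.1) q.2 * √((gt q.1 q.2).det))) (Set.Icc a b ×ˢ cell ρ) := by
    refine ((hflow.continuousOn_scalarCurvature hρ).mono ?_).mul
      (hflow.continuousOn_volume.mono ?_) |>.neg
    · exact fun q hq => ⟨(hI hq.1).1, (hI hq.1).2, cell_subset_strip hq.2⟩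
    · exact fun q hq => ⟨(hI hq.1).1.le, (hI hq.1).2, cell_subset_strip hq.2⟩
  obtain ⟨B, hB⟩ := hK.exists_bound_of_continuousOn hcont
  have hmet := hflow.metric t ht.le htT
  have key := hasDerivAt_integral_of_dominated_loc_of_deriv_le
    (μ := volume.restrict (cell ρ)) (F := fun τ p => √((gt τ p).det)) (bound := fun _ => B)
    (F' := fun τ p => -(scalarCurvature ρ (gt τ) p * √((gt τ p).det))) hab
    (by
      filter_upwards [hab] with τ hτ
      exact (integrableOn_cell (hflow.metric τ (hI hτ).1.le
        (hI hτ).2).smoothOn_volume.continuousOn).aestronglyMeasurable)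
    (integrableOn_cell hmet.smoothOn_volume.continuousOn)
    (integrableOn_cell_mul_volume hmet
      (hmet.smoothOn_scalarCurvature hρ).continuousOn).neg.aestronglyMeasurable
    (by
      filter_upwards [ae_restrict_mem measurableSet_cell] with p hp τ hτ
      exact hB (τ, p) ⟨hτ, hp⟩)
    (integrableOn_cell continuousOn_const)
    (by
      filter_upwards [ae_restrict_mem measurableSet_cell] with p hp τ hτ
      exact hflow.hasDerivAt_volume (hI hτ).1 (hI hτ).2 (cell_subset_strip hp))
  simpa only [area, integralM, one_mul, integral_neg] using key.2

/-- The evolution equation holds only for positive times; continuity down to time `0` lets the area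
estimate start there. -/
theorem IsRicciFlow.continuousOn_area (hflow : IsRicciFlow ρ T g₀ gt) (htT : (t : EReal) < T) :
    ContinuousOn (fun τ => area ρ (gt τ)) (Set.Icc 0 t) := by
  have hlt : ∀ τ ∈ Set.Icc 0 t, (τ : EReal) < T := fun τ hτ =>
    lt_of_le_of_lt (EReal.coe_le_coe_iff.2 hτ.2) htT
  have hcont : ContinuousOn (fun q : ℝ × (ℝ × ℝ) => √((gt q.1 q.2).det))
      (Set.Icc 0 t ×ˢ cell ρ) :=
    hflow.continuousOn_volume.mono fun q hq => ⟨hq.1.1, hlt _ hq.1, cell_subset_strip hq.2⟩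
  obtain ⟨B, hB⟩ := (isCompact_Icc.prod isCompact_cell).exists_bound_of_continuousOn hcont
  intro s hs
  simp only [area, integralM, one_mul]
  refine continuousWithinAt_of_dominated (bound := fun _ => B) ?_ ?_
    (integrableOn_cell continuousOn_const) ?_
  · filter_upwards [self_mem_nhdsWithin] with τ hτ
    exact (integrableOn_cell (hflow.metric τ hτ.1
      (hlt τ hτ)).smoothOn_volume.continuousOn).aestronglyMeasurable
  · filter_upwards [self_mem_nhdsWithin] with τ hτ
    filter_upwards [ae_restrict_mem measurableSet_cell] with p hp
    exact hB (τ, p) ⟨hτ, hp⟩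
  · filter_upwards [ae_restrict_mem measurableSet_cell] with p hp
    exact (hcont.comp (f := fun τ : ℝ => (τ, p)) (by fun_prop)
      fun τ hτ => ⟨hτ, hp⟩) s hs

/-- `A' = -∫ R dA ≤ -a √A` means `(√A)' ≤ -a/2`, so `√A + (a/2) t` is nonincreasing. -/
theorem IsRicciFlow.sqrt_area_add_le (hρ : 0 < ρ) (hflow : IsRicciFlow ρ T g₀ gt) {a : ℝ}
    (hR : ∀ t : ℝ, 0 ≤ t → (t : EReal) < T →
      a * √(area ρ (gt t)) ≤ integralM ρ (gt t) (scalarCurvature ρ (gt t)))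
    {s t : ℝ} (hs : 0 ≤ s) (hst : s ≤ t) (htT : (t : EReal) < T) :
    √(area ρ (gt t)) + a / 2 * t ≤ √(area ρ (gt s)) + a / 2 * s := by
  have hlt : ∀ τ ∈ Set.Icc 0 t, (τ : EReal) < T := fun τ hτ =>
    lt_of_le_of_lt (EReal.coe_le_coe_iff.2 hτ.2) htT
  have hder : ∀ τ ∈ interior (Set.Icc 0 t), HasDerivAt
      (fun τ => √(area ρ (gt τ)) + a / 2 * τ)
      (-integralM ρ (gt τ) (scalarCurvature ρ (gt τ)) / (2 * √(area ρ (gt τ))) + a / 2 * 1) τ := by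
    intro τ hτ
    rw [interior_Icc] at hτ
    have hτT := hlt τ (Set.Ioo_subset_Icc_self hτ)
    exact ((hflow.hasDerivAt_area hρ hτ.1 hτT).sqrt
      ((hflow.metric τ hτ.1.le hτT).area_pos hρ).ne').add ((hasDerivAt_id τ).const_mul _)
  refine antitoneOn_of_deriv_nonpos (f := fun τ => √(area ρ (gt τ)) + a / 2 * τ)
    (convex_Icc 0 t) ((hflow.continuousOn_area htT).sqrt.add (by fun_prop))
    (fun τ hτ => (hder τ hτ).differentiableAt.differentiableWithinAt) (fun τ hτ => ?_)
    ⟨hs, hst⟩ ⟨hs.trans hst, le_rfl⟩ hst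
  rw [(hder τ hτ).deriv]
  rw [interior_Icc] at hτ
  have hτT := hlt τ (Set.Ioo_subset_Icc_self hτ)
  have hpos := Real.sqrt_pos.2 ((hflow.metric τ hτ.1.le hτT).area_pos hρ)
  have := hR τ hτ.1.le hτT
  rw [neg_div, neg_add_nonpos_iff, le_div_iff₀ (by positivity)]
  linarith

/-! ### Boundary length and rescaled time of the normalised flow. -/

theorem IsNormalisation.boundaryLength_eq (hρ : 0 < ρ) {S : EReal} {gn : ℝ → MetricField}
    (hnorm : IsNormalisation ρ T gt S gn) (ht : 0 ≤ t) (htT : (t : EReal) < T)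
    (hA : 0 < area ρ (gt t)) :
    boundaryLength ρ (gn (rescaledTime ρ gt t)) =
      boundaryLength ρ (gt t) / √(area ρ (gt t)) := by
  have h : ∀ p ∈ strip ρ, √(gn (rescaledTime ρ gt t) p 0 0)
      = (√(area ρ (gt t)))⁻¹ * √(gt t p 0 0) := by
    intro p hp
    rw [hnorm.metric_eq t ht htT p hp, Matrix.smul_apply, smul_eq_mul, scaling, one_div,
      Real.sqrt_mul (inv_nonneg.2 hA.le), Real.sqrt_inv]
  have h₁ : ∀ θ : ℝ, (θ, ρ) ∈ strip ρ := fun θ => bdry_subset_strip hρ (Or.inl rfl)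
  have h₂ : ∀ θ : ℝ, (θ, -ρ) ∈ strip ρ := fun θ => bdry_subset_strip hρ (Or.inr rfl)
  simp only [boundaryLength, h _ (h₁ _), h _ (h₂ _), intervalIntegral.integral_const_mul]
  ring

/-- If the geodesic curvature of each boundary component is a negative constant, Gauss–Bonnet
bounds the total curvature below by the length of the boundary. -/
theorem IsMetric.mul_boundaryLength_le (hρ : 0 < ρ) (hg : IsMetric ρ g) {κ k₁ k₂ : ℝ}
    (h₁ : ∀ θ, geodesicCurvature ρ g (θ, ρ) = k₁) (h₂ : ∀ θ, geodesicCurvature ρ g (θ, -ρ) = k₂)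
    (hκ₁ : k₁ ≤ -κ) (hκ₂ : k₂ ≤ -κ) :
    2 * κ * boundaryLength ρ g ≤ integralM ρ g (scalarCurvature ρ g) := by
  rw [hg.gauss_bonnet hρ, boundaryLength]
  simp only [h₁, h₂, intervalIntegral.integral_const_mul]
  have hl : ∀ s, 0 ≤ ∫ θ in (0 : ℝ)..2 * Real.pi, √(g (θ, s) 0 0) := fun s =>
    intervalIntegral.integral_nonneg Real.two_pi_pos.le fun _ _ => Real.sqrt_nonneg _
  nlinarith [mul_le_mul_of_nonneg_right hκ₁ (hl ρ), mul_le_mul_of_nonneg_right hκ₂ (hl (-ρ))]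

theorem rescaledTime_nonneg (ht : 0 ≤ t) : 0 ≤ rescaledTime ρ gt t := by
  refine intervalIntegral.integral_nonneg ht fun τ _ => ?_
  exact one_div_nonneg.2 (integral_nonneg fun p => by simp)

theorem rescaledTime_le {B : ℝ} (ht : 0 ≤ t)
    (hB : ∀ τ ∈ Set.Icc 0 t, 0 < area ρ (gt τ) ∧ 1 / area ρ (gt τ) ≤ B) :
    rescaledTime ρ gt t ≤ B * t := by
  have := intervalIntegral.norm_integral_le_of_norm_le_const (a := 0) (b := t) (C := B)
    (f := scaling ρ gt) fun τ hτ => by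
      rw [Set.uIoc_of_le ht] at hτ
      obtain ⟨h1, h2⟩ := hB τ (Set.Ioc_subset_Icc_self hτ)
      rwa [scaling, Real.norm_of_nonneg (by positivity)]
  rw [sub_zero, abs_of_nonneg ht] at this
  exact (Real.le_norm_self _).trans this

end CylinderFlow

end

/-! ### The three conclusions. -/

theorem mainTheorem5 (ρ : ℝ) (hρ : 0 < ρ) (T S : EReal) (hT : 0 < T)
    (g₀ : CylinderFlow.MetricField) (gt g : ℝ → CylinderFlow.MetricField)
    (hg₀ : CylinderFlow.IsMetric ρ g₀)
    (hflow : CylinderFlow.IsRicciFlow ρ T g₀ gt)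
    (hnorm : CylinderFlow.IsNormalisation ρ T gt S g)
    (hneg : ∀ p ∈ CylinderFlow.bdry ρ, CylinderFlow.geodesicCurvature ρ g₀ p < 0)
    (hconst : ∀ p ∈ CylinderFlow.bdry ρ, ∀ q ∈ CylinderFlow.bdry ρ, p.2 = q.2 →
      CylinderFlow.geodesicCurvature ρ g₀ p = CylinderFlow.geodesicCurvature ρ g₀ q)
    (hlength : ∃ C : ℝ, 0 < C ∧ ∀ t : ℝ, 0 ≤ t → (t : EReal) < S →
      C ≤ CylinderFlow.boundaryLength ρ (g t)) :
    (∃ c₁ : ℝ, 0 < c₁ ∧ ∀ t : ℝ, 0 ≤ t → (t : EReal) < T →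
      c₁ ≤ CylinderFlow.integralM ρ (gt t)
        (fun p => CylinderFlow.scalarCurvature ρ (gt t) p ^ 2)) ∧
    (∃ c₂ : ℝ, 0 < c₂ ∧ ∀ t : ℝ, 0 ≤ t → (t : EReal) < T →
      c₂ * t ≤ CylinderFlow.scalarMax ρ (gt t)) ∧
    (S = ⊤ → ∀ K : ℝ, ∃ t₀ : ℝ, 0 ≤ t₀ ∧ (t₀ : EReal) < T ∧
      ∀ t : ℝ, t₀ ≤ t → (t : EReal) < T → K ≤ CylinderFlow.scalarMax ρ (gt t)) := by
  obtain ⟨C, hC, hlen⟩ := hlength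
  set a : ℝ := 2 * min (-CylinderFlow.geodesicCurvature ρ g₀ (0, ρ))
    (-CylinderFlow.geodesicCurvature ρ g₀ (0, -ρ)) * C with ha
  have hb₁ : ∀ θ : ℝ, (θ, ρ) ∈ CylinderFlow.bdry ρ := fun _ => Or.inl rfl
  have hb₂ : ∀ θ : ℝ, (θ, -ρ) ∈ CylinderFlow.bdry ρ := fun _ => Or.inr rfl
  have hκ : 0 < min (-CylinderFlow.geodesicCurvature ρ g₀ (0, ρ))
      (-CylinderFlow.geodesicCurvature ρ g₀ (0, -ρ)) :=
    lt_min (neg_pos.2 (hneg _ (hb₁ 0))) (neg_pos.2 (hneg _ (hb₂ 0)))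
  have ha0 : 0 < a := by positivity
  have hA : ∀ t : ℝ, 0 ≤ t → (t : EReal) < T → 0 < CylinderFlow.area ρ (gt t) :=
    fun t ht htT => (hflow.metric t ht htT).area_pos hρ
  have hR : ∀ t : ℝ, 0 ≤ t → (t : EReal) < T → a * √(CylinderFlow.area ρ (gt t)) ≤
      CylinderFlow.integralM ρ (gt t) (CylinderFlow.scalarCurvature ρ (gt t)) := by
    intro t ht htT
    have hgb := (hflow.metric t ht htT).mul_boundaryLength_le hρ
      (fun θ => (hflow.geodesicCurvature_eq hρ ht htT (hb₁ θ)).trans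
        (hconst _ (hb₁ θ) _ (hb₁ 0) rfl))
      (fun θ => (hflow.geodesicCurvature_eq hρ ht htT (hb₂ θ)).trans
        (hconst _ (hb₂ θ) _ (hb₂ 0) rfl))
      (le_neg.1 (min_le_left _ _)) (le_neg.1 (min_le_right _ _))
    have hl := hlen _ (CylinderFlow.rescaledTime_nonneg ht) (hnorm.time_lt t ht htT)
    rw [hnorm.boundaryLength_eq hρ ht htT (hA t ht htT),
      le_div_iff₀ (Real.sqrt_pos.2 (hA t ht htT))] at hl
    refine le_trans ?_ hgb
    rw [ha, mul_assoc]
    exact mul_le_mul_of_nonneg_left hl (by positivity)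
  -- From `a √A ≤ R_max A`, cancel one factor `√A`. The bound `m` will be the initial `√A` for the
  -- second claim and a small `δ` for the third.
  have hmax : ∀ t : ℝ, 0 ≤ t → (t : EReal) < T → ∀ m : ℝ, √(CylinderFlow.area ρ (gt t)) ≤ m →
      a / m ≤ CylinderFlow.scalarMax ρ (gt t) := by
    intro t ht htT m hm
    have hs := Real.sqrt_pos.2 (hA t ht htT)
    have h1 := (hR t ht htT).trans ((hflow.metric t ht htT).integralM_scalarCurvature_le hρ)
    have h2 : CylinderFlow.scalarMax ρ (gt t) * CylinderFlow.area ρ (gt t) =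
        CylinderFlow.scalarMax ρ (gt t) * √(CylinderFlow.area ρ (gt t)) *
          √(CylinderFlow.area ρ (gt t)) := by
      rw [mul_assoc, Real.mul_self_sqrt (hA t ht htT).le]
    rw [h2, mul_le_mul_iff_left₀ hs] at h1
    exact (div_le_div_of_nonneg_left ha0.le hs hm).trans ((div_le_iff₀ hs).2 h1)
  have hdec := @CylinderFlow.IsRicciFlow.sqrt_area_add_le ρ T g₀ gt hρ hflow a hR
  set m := √(CylinderFlow.area ρ (gt 0)) with hm
  have hm0 : 0 < m := Real.sqrt_pos.2 (hA 0 le_rfl (by simpa using hT))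
  have htime : ∀ t : ℝ, 0 ≤ t → (t : EReal) < T → t ≤ 2 * m / a := by
    intro t ht htT
    have h1 := hdec le_rfl ht htT
    have h2 := Real.sqrt_nonneg (CylinderFlow.area ρ (gt t))
    rw [le_div_iff₀ ha0]
    linarith
  have hanti : ∀ s t : ℝ, 0 ≤ s → s ≤ t → (t : EReal) < T →
      √(CylinderFlow.area ρ (gt t)) ≤ √(CylinderFlow.area ρ (gt s)) := by
    intro s t hs hst htT
    have h1 := hdec hs hst htT
    nlinarith
  -- The second constant divides the lower bound `a / m` for `R_max` by the bound `2 * m / a` for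
  -- the lifetime.
  refine ⟨⟨a ^ 2, by positivity, fun t ht htT => ?_⟩,
    ⟨a / m / (2 * m / a), by positivity, fun t ht htT => ?_⟩, fun hS K => ?_⟩
  · have h1 := (hflow.metric t ht htT).integralM_scalarCurvature_sq_le hρ
    have h2 := pow_le_pow_left₀ (by positivity) (hR t ht htT) 2
    rw [mul_pow, Real.sq_sqrt (hA t ht htT).le, mul_comm] at h2
    exact le_of_mul_le_mul_left (h2.trans h1) (hA t ht htT)
  · refine le_trans ?_ (hmax t ht htT m (hanti 0 t le_rfl ht htT))
    rw [div_mul_eq_mul_div, div_le_iff₀ (by positivity)]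
    exact mul_le_mul_of_nonneg_left (htime t ht htT) (by positivity)
  -- Chosen so that `a / δ = max K 1 ≥ K`; the `1` keeps `δ` positive for every `K`.
  · set δ := a / max K 1 with hδ
    have hδ0 : 0 < δ := by positivity
    by_cases h : ∃ t₀ : ℝ, 0 ≤ t₀ ∧ (t₀ : EReal) < T ∧ √(CylinderFlow.area ρ (gt t₀)) ≤ δ
    · obtain ⟨t₀, h0, h0T, hle⟩ := h
      refine ⟨t₀, h0, h0T, fun t ht htT => ?_⟩
      have h1 := hmax t (h0.trans ht) htT δ ((hanti t₀ t h0 ht htT).trans hle)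
      rw [hδ, div_div_cancel₀ ha0.ne'] at h1
      exact (le_max_left K 1).trans h1
    · push Not at h
      exfalso
      -- If `√A > δ` throughout, then `φ ≤ 1 / δ²` and the rescaled time never exceeds `1 / δ² * (2
      -- * m / a)`; yet `S = ⊤` makes it reach one more than that.
      obtain ⟨τ, hτ, hτT, heq⟩ := hnorm.time_surj (1 / δ ^ 2 * (2 * m / a) + 1) (by positivity)
        (hS ▸ EReal.coe_lt_top _)
      have hle : CylinderFlow.rescaledTime ρ gt τ ≤ 1 / δ ^ 2 * τ := by
        refine CylinderFlow.rescaledTime_le hτ fun σ hσ => ?_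
        have hσT : (σ : EReal) < T := lt_of_le_of_lt (EReal.coe_le_coe_iff.2 hσ.2) hτT
        exact ⟨hA σ hσ.1 hσT, one_div_le_one_div_of_le (by positivity)
          ((Real.le_sqrt' hδ0).1 (h σ hσ.1 hσT).le)⟩
      have := mul_le_mul_of_nonneg_left (htime τ hτ hτT) (by positivity : 0 ≤ 1 / δ ^ 2)
      linarith
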